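/- Consider three agents at positions $\mathbf p_1,\mathbf p_2,\mathbf p_3\in\mathbb R^2$ and write $\mathbf p=(\mathbf p_1,\mathbf p_2,\mathbf p_3)\in\mathbb R^6$. Fix desired distances $d_{12}^*,d_{13}^*$ and a desired angle $\theta^*\in[0,\pi]$. For $\mathbf p$ in the open set $D=\{\mathbf p:\mathbf p_1\ne\mathbf p_2,\ \mathbf p_1\neq\mathbf p_3\}$ let $\theta_{23}^1\in[0,\pi]$ be the angle at $\mathbf p_1$ subtended by $\mathbf p_2$ and $\mathbf p_3$, and put $$F_W(\mathbf p)=\big(\|\mathbf p_1-\mathbf p_2\|^2,\ \|\mathbf p_1-\mathbf p_3\|^2,\ \cos\theta_{23}^1\big)^\top,\qquad R_W(\mathbf p)=\frac{\partial F_W}{\partial\mathbf p}(\mathbf p)\in\mathbb R^{3\times 6},$$ $$\mathbf e(\mathbf p)=(e_{12},e_{13},e_{23}^1)^\top=F_W(\mathbf p)-\big((d_{12}^*)^2,(d_{13}^*)^2,\cos\theta^*\big)^\top .$$ Consider the gradient control system $\dot{\mathbf p}=u(\mathbf p):=-R_W(\mathbf p)^\top\mathbf e(\mathbf p)$ on $D$,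 with negative Jacobian $J(\mathbf p)=-\partial u/\partial\mathbf p\in\mathbb R^{6\times6}$, so that the linearization at an equilibrium $\mathbf p_*$ is $\dot x=-J(\mathbf p_*)x$. With $a=\|\mathbf p_1-\mathbf p_2\|$, $b=\|\mathbf p_1-\mathbf p_3\|$, $c=\cos\theta_{23}^1$, let $$E(\mathbf p)=\begin{bmatrix}2e_{12}+2e_{13}&-2e_{12}&-2e_{13}\\-2e_{12}&2e_{12}&0\\-2e_{13}&0&2e_{13}\end{bmatrix}+e_{23}^1\begin{bmatrix}\frac{2}{ab}-\frac{c}{a^2}-\frac{c}{b^2}&-\frac1{ab}+\frac c{a^2}&-\frac1{ab}+\frac c{b^2}\\-\frac1{ab}+\frac c{a^2}&-\frac c{a^2}&\frac1{ab}\\-\frac1{ab}+\frac c{b^2}&\frac1{ab}&-\frac c{b^2}\end{bmatrix},$$ the symmetric matrix for which $u(\mathbf p)=-(E(\mathbf p)\otimes I_2)\mathbf p$. Let $\mathbf p_*\in D$ be an incorrect equilibrium, that is, $R_W(\mathbf p_*)^\top\mathbf e(\mathbf p_*)=0$ and $\mathbf e(\mathbf p_*)\neq0$. Then: 1. $\mathbf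 p_*$ is an unstable equilibrium of the system, that is, it is not stable in the sense of Lyapunov: there is $\varepsilon>0$ such that for every $\delta>0$ some solution in $D$ starts at distance less than $\delta$ from $\mathbf p_*$ and is at distance at least $\varepsilon$ from $\mathbf p_*$ at some later time. 2. The three agents are collinear at $\mathbf p_*$. 3. $E(\mathbf p_*)$ has a negative eigenvalue. 4. $J(\mathbf p_*)$ has a negative eigenvalue. 5. For every rotation $Q\in SO(2)$ such that $Q\mathbf p_{*1},Q\mathbf p_{*2},Q\mathbf p_{*3}$ have the same second coordinate, the matrix $(I_3\otimes Q)\,J(\mathbf p_*)\,(I_3\otimes Q)^\top$, with the three first coordinates of the agents listed before the three second coordinates, is block diagonal, $\begin{bmatrix}J_{11}&0\\0&E(\mathbf p_*)\end{bmatrix}$ for some $J_{11}\in\mathbb R^{3\times3}$. -/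

import Mathlib

open Matrix
open scoped Kronecker

noncomputable section

namespace WeakRigidity

/-- Configurations `p = (p₁, p₂, p₃) ∈ ℝ⁶` of three agents in the plane. The coordinate `(i, k)` is
the `k`-th coordinate of the position of agent `i`; agents `1, 2, 3` are indexed by `0, 1, 2`. -/
abbrev Config : Type := EuclideanSpace ℝ (Fin 3 × Fin 2)

/-- The position of agent `i`. -/
def pos (p : Config) (i : Fin 3) : EuclideanSpace ℝ (Fin 2) :=
  WithLp.toLp 2 fun k => p (i, k)

/-- The configurations at which the angle at agent 1 subtended by agents 2 and 3 is defined. -/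
def admissible : Set Config :=
  {p | pos p 0 ≠ pos p 1 ∧ pos p 0 ≠ pos p 2}

/-- The cosine of the angle at agent 1 subtended by agents 2 and 3. -/
def cosAngle (p : Config) : ℝ :=
  Real.cos (EuclideanGeometry.angle (pos p 1) (pos p 0) (pos p 2))

/-- The weak rigidity function for the edges `(1,2)`, `(1,3)` and the angle at agent 1:
`(‖p₁ - p₂‖², ‖p₁ - p₃‖², cos θ)`. -/
def rigidityFun (p : Config) : Fin 3 → ℝ :=
  ![‖pos p 0 - pos p 1‖ ^ 2, ‖pos p 0 - pos p 2‖ ^ 2, cosAngle p]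

/-- The weak rigidity matrix: the Jacobian of the weak rigidity function. -/
def rigidityMatrix (p : Config) : Matrix (Fin 3) (Fin 3 × Fin 2) ℝ :=
  Matrix.of fun r j =>
    fderiv ℝ (fun q : Config => rigidityFun q r) p (EuclideanSpace.single j 1)

/-- The error vector `(e₁₂, e₁₃, e₂₃¹)` for the desired distances `d12`, `d13` and the desired
angle `θ`. -/
def err (d12 d13 θ : ℝ) (p : Config) : Fin 3 → ℝ :=
  rigidityFun p - ![d12 ^ 2, d13 ^ 2, Real.cos θ]

/-- The gradient control law `u(p) = -R_W(p)ᵀ e(p)`; the system is `ṗ = u(p)`. -/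
def control (d12 d13 θ : ℝ) (p : Config) : Config :=
  WithLp.toLp 2 (-((rigidityMatrix p)ᵀ *ᵥ err d12 d13 θ p))

/-- The incorrect equilibria: `R_W(p)ᵀ e(p) = 0` and `e(p) ≠ 0`. -/
def incorrectEquilibria (d12 d13 θ : ℝ) : Set Config :=
  {p | p ∈ admissible ∧ (rigidityMatrix p)ᵀ *ᵥ err d12 d13 θ p = 0 ∧ err d12 d13 θ p ≠ 0}

/-- The matrix of coefficients of `p₁, p₂, p₃` in the gradients of `cos θ₂₃¹`: row `i` lists the
scalars `a₁, a₂, a₃` in `∂ cos θ₂₃¹ / ∂ pᵢ = a₁ p₁ + a₂ p₂ + a₃ p₃`, as obtained by differentiating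
`⟪p₁ - p₂, p₁ - p₃⟫ / (‖p₁ - p₂‖ ‖p₁ - p₃‖)`. -/
def cosCoeff (p : Config) : Matrix (Fin 3) (Fin 3) ℝ :=
  let a := ‖pos p 0 - pos p 1‖
  let b := ‖pos p 0 - pos p 2‖
  let c := cosAngle p
  !![2 / (a * b) - c / a ^ 2 - c / b ^ 2, -1 / (a * b) + c / a ^ 2, -1 / (a * b) + c / b ^ 2;
     -1 / (a * b) + c / a ^ 2,            -c / a ^ 2,               1 / (a * b);
     -1 / (a * b) + c / b ^ 2,            1 / (a * b),              -c / b ^ 2]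

/-- The matrix `E(p)` with `u(p) = -(E(p) ⊗ I₂) p`. -/
def matE (d12 d13 θ : ℝ) (p : Config) : Matrix (Fin 3) (Fin 3) ℝ :=
  let e := err d12 d13 θ p
  !![2 * e 0 + 2 * e 1, -2 * e 0, -2 * e 1;
     -2 * e 0,          2 * e 0,  0;
     -2 * e 1,          0,        2 * e 1] + e 2 • cosCoeff p

/-- The negative Jacobian `J(p) = -∂u/∂p` of the system; its linearization at an equilibrium `p`
is `ẋ = -J(p) x`. -/
def negJacobian (d12 d13 θ : ℝ) (p : Config) : Matrix (Fin 3 × Fin 2) (Fin 3 × Fin 2) ℝ :=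
  Matrix.of fun i j => -(fderiv ℝ (control d12 d13 θ) p (EuclideanSpace.single j 1)) i

/-- The ordering of the coordinates that lists the three first coordinates of the agents, then the
three second coordinates. -/
def coordOrder : Fin 3 ⊕ Fin 3 → Fin 3 × Fin 2 :=
  Sum.elim (fun i => (i, 0)) (fun i => (i, 1))

/-- The negative Jacobian in the planar frame rotated by `Q`, with all first coordinates listed
before all second coordinates. -/
def rotatedNegJacobian (d12 d13 θ : ℝ) (Q : Matrix (Fin 2) (Fin 2) ℝ) (p : Config) :
    Matrix (Fin 3 ⊕ Fin 3) (Fin 3 ⊕ Fin 3) ℝ :=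
  (((1 : Matrix (Fin 3) (Fin 3) ℝ) ⊗ₖ Q) * negJacobian d12 d13 θ p *
    ((1 : Matrix (Fin 3) (Fin 3) ℝ) ⊗ₖ Q)ᵀ).submatrix coordOrder coordOrder

/-- A real square matrix has a negative eigenvalue. -/
def HasNegEigenvalue {n : Type*} [Fintype n] [DecidableEq n] (A : Matrix n n ℝ) : Prop :=
  ∃ μ : ℝ, μ < 0 ∧ Module.End.HasEigenvalue (Matrix.toLin' A) μ

/-- `x` is a solution on `[0, T]` of `ẋ = f(x)` that stays in the domain `D` of `f`. -/
def IsTrajectory {X : Type*} [NormedAddCommGroup X] [NormedSpace ℝ X]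
    (f : X → X) (D : Set X) (T : ℝ) (x : ℝ → X) : Prop :=
  ∀ t ∈ Set.Icc 0 T, x t ∈ D ∧ HasDerivWithinAt x (f (x t)) (Set.Icc 0 T) t

/-- Stability in the sense of Lyapunov of the point `x₀` for the system `ẋ = f(x)` on `D`:
trajectories that start close to `x₀` stay close to `x₀` as long as they exist. -/
def IsStable {X : Type*} [NormedAddCommGroup X] [NormedSpace ℝ X]
    (f : X → X) (D : Set X) (x₀ : X) : Prop :=
  ∀ ε > 0, ∃ δ > 0, ∀ (T : ℝ) (x : ℝ → X), IsTrajectory f D T x → ‖x 0 - x₀‖ < δ →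
    ∀ t ∈ Set.Icc 0 T, ‖x t - x₀‖ < ε

end WeakRigidity

end

/-! Write X = p₂ - p₁, Y = p₃ - p₁, a = ‖X‖, b = ‖Y‖, c = cos θ₂₃¹, e = e₂₃¹. The cosine does not
change when agent 2 or agent 3 moves radially from agent 1, so pairing the equilibrium equation of
agent 2 with X, and that of agent 3 with Y, leaves e₁₂ = e₁₃ = 0. Hence e ≠ 0, and the equation of
agent 2 becomes Y = (cb/a) X: the agents are collinear and c² = 1. Moreover c e = 1 - c cos θ* > 0,
and E = -(c e) v vᵀ with v = `escapeVec`, so v is an eigenvector with a negative eigenvalue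
(`incorrectEquilibria_spec`, `matE_eq`).

A displacement normal to the line leaves a, b, c unchanged to first order, and E depends on these
alone. So J acts on such displacements as E does; this gives the negative eigenvalue of J and the
lower right block.

Instability is not deduced from the spectrum of J but from Chetaev's criterion
(`not_isStable_of_chetaev`), applied to W = 1 - σ cos θ₂₃¹ with σ = c(p_*) = ±1. Along the flow, cos
θ₂₃¹ has derivative -(1 - cos² θ₂₃¹) · `angleRate`; since σ² = 1, the derivative of W is a
continuous multiple of W, and the factor is positive at p_*. Thus W grows exponentially while it
stays bounded by 2, so trajectories starting near p_* with W > 0 must leave a fixed ball. -/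

noncomputable section

namespace WeakRigidity

/-! ### Chetaev's instability criterion -/

section Instability

open Set Metric Filter Topology NNReal

/-- A globally bounded and Lipschitz vector field has a solution on every interval `[0, T]`. -/
theorem exists_trajectory_of_lipschitzWith {X : Type*} [NormedAddCommGroup X] [NormedSpace ℝ X]
    [CompleteSpace X] {g : X → X} {K : ℝ≥0} (hg : LipschitzWith K g) {C : ℝ}
    (hC : ∀ x, ‖g x‖ ≤ C) (q : X) {T : ℝ} (hT : 0 ≤ T) :
    ∃ y : ℝ → X, y 0 = q ∧ IsTrajectory g univ T y := by
  lift C to ℝ≥0 using (norm_nonneg _).trans (hC q)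
  lift T to ℝ≥0 using hT
  -- At speed at most C a solution stays within distance C * T of q up to time T, so this radius
  -- puts no restriction on T.
  have hpl : IsPicardLindelof (fun _ : ℝ => g) (⟨0, le_rfl, T.2⟩ : Icc (0 : ℝ) T) q (C * T) 0 C K :=
    IsPicardLindelof.of_time_independent (fun x _ => hC x) hg.lipschitzOnWith (by simp)
  obtain ⟨y, hy0, hy⟩ := hpl.exists_eq_forall_mem_Icc_hasDerivWithinAt₀
  exact ⟨y, hy0, fun t ht => ⟨mem_univ _, hy t ht⟩⟩

/-- A vector field that is `C¹` near a closed ball agrees on that ball with a bounded, globally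
Lipschitz vector field. -/
theorem exists_lipschitzWith_eqOn_closedBall {X : Type*} [NormedAddCommGroup X] [NormedSpace ℝ X]
    [FiniteDimensional ℝ X] {f : X → X} {x₀ : X} {r R : ℝ} (hr : 0 < r) (hrR : r < R)
    (hf : ∀ x ∈ closedBall x₀ R, ContDiffAt ℝ 1 f x) :
    ∃ (g : X → X) (K : ℝ≥0) (C : ℝ), LipschitzWith K g ∧ (∀ x, ‖g x‖ ≤ C) ∧
      EqOn g f (closedBall x₀ r) := by
  let χ : ContDiffBump x₀ := ⟨r, R, hr, hrR⟩
  have hsupp : tsupport (fun x => χ x • f x) ⊆ closedBall x₀ R :=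
    (tsupport_smul_subset_left _ _).trans χ.tsupport_eq.subset
  have hsmooth : ContDiff ℝ 1 fun x => χ x • f x := by
    rw [contDiff_iff_contDiffAt]
    intro x
    by_cases hx : x ∈ closedBall x₀ R
    · exact χ.contDiffAt.smul (hf x hx)
    · have h0 : (fun x => χ x • f x) =ᶠ[𝓝 x] 0 :=
        notMem_tsupport_iff_eventuallyEq.mp fun h => hx (hsupp h)
      exact contDiffAt_const.congr_of_eventuallyEq h0
  have hcpt : HasCompactSupport fun x => χ x • f x := χ.hasCompactSupport.smul_right
  obtain ⟨K, hK⟩ := ContDiff.lipschitzWith_of_hasCompactSupport hcpt hsmooth one_ne_zero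
  obtain ⟨C, hC⟩ := hcpt.exists_bound_of_continuous hsmooth.continuous
  exact ⟨_, K, C, hK, hC, fun x hx => by simp [χ.one_of_mem_closedBall hx]⟩

/-- If trajectories of `f` that start near `x₀` cannot leave the `ε`-ball, and `g` agrees with `f`
on that ball, then neither can trajectories of `g`. -/
theorem norm_sub_lt_of_eqOn_closedBall {X : Type*} [NormedAddCommGroup X] [NormedSpace ℝ X]
    {f g : X → X} {D : Set X} {x₀ : X} {ε δ T : ℝ}
    (hD : closedBall x₀ ε ⊆ D) (hfg : EqOn g f (closedBall x₀ ε))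
    (hstab : ∀ (T : ℝ) (x : ℝ → X), IsTrajectory f D T x → ‖x 0 - x₀‖ < δ →
      ∀ t ∈ Icc 0 T, ‖x t - x₀‖ < ε)
    {y : ℝ → X} (hy : IsTrajectory g univ T y) (h0 : ‖y 0 - x₀‖ < δ) (h0' : ‖y 0 - x₀‖ < ε) :
    ∀ t ∈ Icc 0 T, ‖y t - x₀‖ < ε := by
  by_contra! ⟨t, ht, hte⟩
  have hyc : ContinuousOn y (Icc 0 T) := fun t ht => (hy t ht).2.continuousWithinAt
  have hcont : ContinuousOn (fun t => ‖y t - x₀‖) (Icc 0 T) := (hyc.sub continuousOn_const).norm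
  have hS : IsCompact (Icc 0 T ∩ (fun t => ‖y t - x₀‖) ⁻¹' Ici ε) :=
    isCompact_Icc.of_isClosed_subset (hcont.preimage_isClosed_of_isClosed isClosed_Icc isClosed_Ici)
      inter_subset_left
  obtain ⟨t₁, ⟨ht₁, ht₁ε⟩, hmin⟩ := hS.exists_isLeast ⟨t, ht, hte⟩
  have hsub : Icc 0 t₁ ⊆ Icc 0 T := Icc_subset_Icc_right ht₁.2
  -- t₁ is the first time at distance at least ε; by the intermediate value theorem the distance
  -- there is exactly ε. So y stays in the closed ball up to t₁ and is a trajectory of f there,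
  -- which stability forbids.
  obtain ⟨s, hs, hsε⟩ := intermediate_value_Icc ht₁.1 (hcont.mono hsub) ⟨h0'.le, ht₁ε⟩
  have hst : t₁ = s := le_antisymm (hmin ⟨hsub hs, hsε.ge⟩) hs.2
  have hball : ∀ s ∈ Icc 0 t₁, y s ∈ closedBall x₀ ε := by
    intro u hu
    rw [mem_closedBall_iff_norm]
    by_contra! hlt
    have := hmin ⟨hsub hu, hlt.le⟩
    have hut : u = s := (hst ▸ le_antisymm hu.2 this)
    rw [hut] at hlt
    exact hlt.ne' hsε
  have htraj : IsTrajectory f D t₁ y := fun u hu =>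
    ⟨hD (hball u hu), hfg (hball u hu) ▸ (hy u (hsub hu)).2.mono hsub⟩
  exact (hstab t₁ y htraj h0 t₁ ⟨ht₁.1, le_rfl⟩).not_ge ht₁ε

/-- Exponential lower bound from a linear differential inequality. -/
theorem mul_exp_le_of_mul_le_hasDerivWithinAt {h h' : ℝ → ℝ} {κ T : ℝ} (hT : 0 ≤ T)
    (hh : ∀ t ∈ Icc 0 T, HasDerivWithinAt h (h' t) (Icc 0 T) t)
    (hle : ∀ t ∈ Icc 0 T, κ * h t ≤ h' t) : h 0 * Real.exp (κ * T) ≤ h T := by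
  -- Integrating factor: the hypothesis makes this derivative nonnegative.
  have hd : ∀ t ∈ Icc 0 T, HasDerivWithinAt (fun t => h t * Real.exp (-(κ * t)))
      ((h' t - κ * h t) * Real.exp (-(κ * t))) (Icc 0 T) t := by
    intro t ht
    have he : HasDerivAt (fun t : ℝ => Real.exp (-(κ * t))) (Real.exp (-(κ * t)) * -(κ * 1)) t :=
      ((hasDerivAt_id t).const_mul κ).neg.exp
    exact ((hh t ht).mul he.hasDerivWithinAt).congr_deriv (by ring)
  have hmono : MonotoneOn (fun t => h t * Real.exp (-(κ * t))) (Icc 0 T) :=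
    monotoneOn_of_hasDerivWithinAt_nonneg (convex_Icc 0 T)
      (fun t ht => (hd t ht).continuousWithinAt)
      (fun t ht => (hd t (interior_subset ht)).mono interior_subset)
      fun t ht => mul_nonneg (sub_nonneg.2 (hle t (interior_subset ht))) (Real.exp_nonneg _)
  have := hmono ⟨le_rfl, hT⟩ ⟨hT, le_rfl⟩ hT
  simp only [mul_zero, neg_zero, Real.exp_zero, mul_one] at this
  calc h 0 * Real.exp (κ * T) ≤ h T * Real.exp (-(κ * T)) * Real.exp (κ * T) := by gcongr
    _ = h T := by rw [mul_assoc, ← Real.exp_add]; simp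

/-- **Chetaev's instability criterion** for a bounded function that grows exponentially along the
trajectories near `x₀` and takes positive values arbitrarily close to `x₀`. -/
theorem not_isStable_of_chetaev {X : Type*} [NormedAddCommGroup X] [NormedSpace ℝ X]
    [FiniteDimensional ℝ X] {f : X → X} {D : Set X} {x₀ : X} {W : X → ℝ} {W' : X → X →L[ℝ] ℝ}
    {κ M : ℝ} (hκ : 0 < κ) (hM : ∀ x, W x ≤ M)
    (hf : ∀ᶠ x in 𝓝 x₀, ContDiffAt ℝ 1 f x) (hD : D ∈ 𝓝 x₀)
    (hW : ∀ᶠ x in 𝓝 x₀, HasFDerivAt W (W' x) x)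
    (hgrow : ∀ᶠ x in 𝓝 x₀, κ * W x ≤ W' x (f x))
    (hpos : ∃ᶠ x in 𝓝 x₀, 0 < W x) : ¬ IsStable f D x₀ := by
  intro hstable
  obtain ⟨R, hR, hball⟩ := nhds_basis_closedBall.mem_iff.mp
    (hf.and (hW.and (hgrow.and hD)))
  have hsub : closedBall x₀ (R / 2) ⊆ closedBall x₀ R := closedBall_subset_closedBall (by linarith)
  -- Stability constrains only the trajectories that exist, so one of arbitrary length must be
  -- produced. The modified field g provides it, and stability itself keeps it where g = f.
  obtain ⟨g, K, C, hgK, hgC, hgf⟩ := exists_lipschitzWith_eqOn_closedBall (f := f) (x₀ := x₀)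
    (half_pos hR) (half_lt_self hR) fun x hx => (hball hx).1
  obtain ⟨δ, hδ, hstab⟩ := hstable (R / 2) (half_pos hR)
  obtain ⟨q, hq, hqδ, hqR⟩ := (hpos.and_eventually
    (inter_mem (ball_mem_nhds x₀ hδ) (ball_mem_nhds x₀ (half_pos hR)))).exists
  rw [mem_ball_iff_norm] at hqδ hqR
  obtain ⟨T, hTM, hT⟩ : ∃ T : ℝ, M < W q * Real.exp (κ * T) ∧ 0 ≤ T := by
    have : Tendsto (fun T : ℝ => W q * Real.exp (κ * T)) atTop atTop :=
      (Real.tendsto_exp_atTop.comp (tendsto_id.const_mul_atTop hκ)).const_mul_atTop hq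
    exact ((this.eventually_gt_atTop M).and (eventually_ge_atTop 0)).exists
  obtain ⟨y, rfl, hy⟩ := exists_trajectory_of_lipschitzWith hgK hgC q hT
  have hstay := norm_sub_lt_of_eqOn_closedBall (fun x hx => (hball (hsub hx)).2.2.2) hgf hstab hy
    hqδ hqR
  have hmem : ∀ t ∈ Icc 0 T, y t ∈ closedBall x₀ (R / 2) := fun t ht =>
    mem_closedBall_iff_norm.mpr (hstay t ht).le
  refine hTM.not_ge ((mul_exp_le_of_mul_le_hasDerivWithinAt (h := W ∘ y)
    (h' := fun t => W' (y t) (f (y t))) hT (fun t ht => ?_) fun t ht => ?_).trans (hM (y T)))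
  · rw [← hgf (hmem t ht)]
    exact (hball (hsub (hmem t ht))).2.1.comp_hasDerivWithinAt t (hy t ht).2
  · exact (hball (hsub (hmem t ht))).2.2.1

end Instability

/-! ### Derivatives of the distances and the cosine; the control law through E -/

section Geometry

open scoped InnerProductSpace Topology

/-- The position of agent `i` relative to the first agent, as a linear function of the
configuration. -/
def relPos (i : Fin 3) : Config →L[ℝ] EuclideanSpace ℝ (Fin 2) :=
  LinearMap.toContinuousLinearMap
    { toFun := fun q => pos q i - pos q 0
      map_add' := fun q q' => by ext k; simp [pos]; ring
      map_smul' := fun r q => by ext k; simp [pos]; ring }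

theorem relPos_eq (i : Fin 3) (q : Config) : relPos i q = pos q i - pos q 0 := rfl

theorem relPos_apply (i : Fin 3) (q : Config) (k : Fin 2) :
    relPos i q k = q (i, k) - q (0, k) := rfl

theorem relPos_single (i j : Fin 3) (k : Fin 2) (r : ℝ) :
    relPos i (EuclideanSpace.single (j, k) r) =
      EuclideanSpace.single k ((if i = j then r else 0) - if 0 = j then r else 0) := by
  ext l
  by_cases hl : l = k <;> simp [relPos_apply, hl]

theorem norm_pos_sub (i : Fin 3) (q : Config) : ‖pos q 0 - pos q i‖ = ‖relPos i q‖ := by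
  rw [relPos_eq, norm_sub_rev]

theorem cosAngle_eq (q : Config) :
    cosAngle q = ⟪relPos 1 q, relPos 2 q⟫_ℝ / (‖relPos 1 q‖ * ‖relPos 2 q‖) := by
  rw [cosAngle, EuclideanGeometry.angle, InnerProductGeometry.cos_angle]
  rfl

theorem mem_admissible_iff {q : Config} :
    q ∈ admissible ↔ relPos 1 q ≠ 0 ∧ relPos 2 q ≠ 0 := by
  simp only [admissible, Set.mem_ofPred_eq, relPos_eq, sub_ne_zero, ne_comm]

theorem isOpen_admissible : IsOpen admissible := by
  have : admissible = {q : Config | relPos 1 q ≠ 0} ∩ {q | relPos 2 q ≠ 0} :=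
    Set.ext fun q => mem_admissible_iff
  rw [this]
  exact (isOpen_ne_fun (relPos 1).continuous continuous_const).inter
    (isOpen_ne_fun (relPos 2).continuous continuous_const)

theorem inner_relPos {q : Config} (hq : q ∈ admissible) :
    ⟪relPos 1 q, relPos 2 q⟫_ℝ = cosAngle q * (‖relPos 1 q‖ * ‖relPos 2 q‖) := by
  obtain ⟨h1, h2⟩ := mem_admissible_iff.mp hq
  rw [cosAngle_eq, div_mul_cancel₀]
  exact mul_ne_zero (norm_ne_zero_iff.2 h1) (norm_ne_zero_iff.2 h2)

/-- The derivative of the distance of agent `i` from the first agent. -/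
def normDeriv (i : Fin 3) (q : Config) : Config →L[ℝ] ℝ :=
  ‖relPos i q‖⁻¹ • (innerSL ℝ (relPos i q)).comp (relPos i)

theorem normDeriv_apply (i : Fin 3) (q v : Config) :
    normDeriv i q v = ‖relPos i q‖⁻¹ * ⟪relPos i q, relPos i v⟫_ℝ := rfl

/-- The derivative of the cosine of the angle at the first agent. -/
def cosDeriv (q : Config) : Config →L[ℝ] ℝ :=
  (‖relPos 1 q‖ * ‖relPos 2 q‖)⁻¹ •
      ((innerSL ℝ (relPos 2 q)).comp (relPos 1) + (innerSL ℝ (relPos 1 q)).comp (relPos 2)) -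
    (cosAngle q / ‖relPos 1 q‖ ^ 2) • (innerSL ℝ (relPos 1 q)).comp (relPos 1) -
    (cosAngle q / ‖relPos 2 q‖ ^ 2) • (innerSL ℝ (relPos 2 q)).comp (relPos 2)

theorem cosDeriv_apply (q v : Config) :
    cosDeriv q v = (‖relPos 1 q‖ * ‖relPos 2 q‖)⁻¹ *
        (⟪relPos 2 q, relPos 1 v⟫_ℝ + ⟪relPos 1 q, relPos 2 v⟫_ℝ) -
      cosAngle q / ‖relPos 1 q‖ ^ 2 * ⟪relPos 1 q, relPos 1 v⟫_ℝ -
      cosAngle q / ‖relPos 2 q‖ ^ 2 * ⟪relPos 2 q, relPos 2 v⟫_ℝ := rfl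

theorem hasFDerivAt_norm_sq (i : Fin 3) (q : Config) :
    HasFDerivAt (fun q => ‖relPos i q‖ ^ 2) (2 • (innerSL ℝ (relPos i q)).comp (relPos i)) q :=
  (relPos i).hasFDerivAt.norm_sq

theorem hasFDerivAt_norm {i : Fin 3} {q : Config} (h : relPos i q ≠ 0) :
    HasFDerivAt (fun q => ‖relPos i q‖) (normDeriv i q) q := by
  have h0 : ‖relPos i q‖ ≠ 0 := norm_ne_zero_iff.2 h
  have := (hasFDerivAt_norm_sq i q).sqrt (pow_ne_zero 2 h0)
  simp only [Real.sqrt_sq (norm_nonneg _)] at this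
  refine this.congr_fderiv ?_
  ext v
  simp [normDeriv_apply]
  field_simp

theorem hasFDerivAt_cosAngle {q : Config} (hq : q ∈ admissible) :
    HasFDerivAt cosAngle (cosDeriv q) q := by
  obtain ⟨h1, h2⟩ := mem_admissible_iff.mp hq
  have ha : ‖relPos 1 q‖ ≠ 0 := norm_ne_zero_iff.2 h1
  have hb : ‖relPos 2 q‖ ≠ 0 := norm_ne_zero_iff.2 h2
  rw [funext fun q => (cosAngle_eq q).trans (div_eq_mul_inv _ _)]
  have hi := ((relPos 1).hasFDerivAt (x := q)).inner ℝ ((relPos 2).hasFDerivAt (x := q))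
  have hn := (hasFDerivAt_norm h1).mul (hasFDerivAt_norm h2)
  refine (hi.mul ((hasDerivAt_inv (mul_ne_zero ha hb)).comp_hasFDerivAt q hn)).congr_fderiv ?_
  ext v
  simp [cosDeriv_apply, cosAngle_eq, normDeriv_apply, fderivInnerCLM_apply,
    real_inner_comm (relPos 2 q) (relPos 1 v)]
  field_simp
  ring

/-- Order 2 is needed because the control law contains the first derivative and must itself be C¹.
-/
theorem contDiffAt_rigidityFun {q : Config} (hq : q ∈ admissible) (r : Fin 3) :
    ContDiffAt ℝ 2 (fun q => rigidityFun q r) q := by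
  obtain ⟨h1, h2⟩ := mem_admissible_iff.mp hq
  have ha : ‖relPos 1 q‖ ≠ 0 := norm_ne_zero_iff.2 h1
  have hb : ‖relPos 2 q‖ ≠ 0 := norm_ne_zero_iff.2 h2
  have c1 := (relPos 1).contDiff.contDiffAt (n := 2) (x := q)
  have c2 := (relPos 2).contDiff.contDiffAt (n := 2) (x := q)
  fin_cases r
  · simpa [rigidityFun, norm_pos_sub] using c1.norm_sq ℝ
  · simpa [rigidityFun, norm_pos_sub] using c2.norm_sq ℝ
  · change ContDiffAt ℝ 2 cosAngle q
    rw [funext cosAngle_eq]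
    exact (c1.inner ℝ c2).div ((c1.norm ℝ h1).mul (c2.norm ℝ h2)) (mul_ne_zero ha hb)

theorem contDiffAt_control (d12 d13 θ : ℝ) {q : Config} (hq : q ∈ admissible) :
    ContDiffAt ℝ 1 (control d12 d13 θ) q := by
  rw [contDiffAt_euclidean]
  intro j
  have : (fun q => control d12 d13 θ q j) = fun q => -∑ r,
      fderiv ℝ (fun q : Config => rigidityFun q r) q (EuclideanSpace.single j 1) *
        (rigidityFun q r - ![d12 ^ 2, d13 ^ 2, Real.cos θ] r) := rfl
  rw [this]
  refine (ContDiffAt.sum fun r _ => ContDiffAt.mul ?_ ?_).neg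
  · exact ((contDiffAt_rigidityFun hq r).fderiv_right (m := 1) le_rfl).clm_apply contDiffAt_const
  · exact ((contDiffAt_rigidityFun hq r).of_le (by norm_num)).sub contDiffAt_const

/-- The control law in terms of the matrix `E`. -/
theorem control_apply (d12 d13 θ : ℝ) {q : Config} (hq : q ∈ admissible) (i : Fin 3) (k : Fin 2) :
    control d12 d13 θ q (i, k) = -∑ j, matE d12 d13 θ q i j * q (j, k) := by
  have key : control d12 d13 θ q (i, k) = -∑ r,
      fderiv ℝ (fun q : Config => rigidityFun q r) q (EuclideanSpace.single (i, k) 1) *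
        err d12 d13 θ q r := rfl
  obtain ⟨h1, h2⟩ := mem_admissible_iff.mp hq
  have ha : ‖relPos 1 q‖ ≠ 0 := norm_ne_zero_iff.2 h1
  have hb : ‖relPos 2 q‖ ≠ 0 := norm_ne_zero_iff.2 h2
  have f0 : fderiv ℝ (fun q : Config => rigidityFun q 0) q =
      2 • (innerSL ℝ (relPos 1 q)).comp (relPos 1) := by
    simpa [rigidityFun, norm_pos_sub] using (hasFDerivAt_norm_sq 1 q).fderiv
  have f1 : fderiv ℝ (fun q : Config => rigidityFun q 1) q =
      2 • (innerSL ℝ (relPos 2 q)).comp (relPos 2) := by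
    simpa [rigidityFun, norm_pos_sub] using (hasFDerivAt_norm_sq 2 q).fderiv
  have f2 : fderiv ℝ (fun q : Config => rigidityFun q 2) q = _ :=
    (hasFDerivAt_cosAngle hq).fderiv
  rw [key, Fin.sum_univ_three, f0, f1, f2]
  simp only [matE, cosCoeff, norm_pos_sub]
  generalize err d12 d13 θ q = e
  fin_cases i <;>
    simp [cosDeriv_apply, relPos_single, EuclideanSpace.inner_single_right, Fin.sum_univ_three,
      relPos_apply] <;> field_simp <;> ring

/-- Translation invariance of the control law; it lets positions be replaced by positions relative
to agent 1. -/
theorem sum_matE (d12 d13 θ : ℝ) (q : Config) (i : Fin 3) : ∑ j, matE d12 d13 θ q i j = 0 := by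
  fin_cases i <;> simp [matE, cosCoeff, Fin.sum_univ_three] <;> ring

end Geometry

/-! ### Structure of incorrect equilibria and the spectrum of E -/

section Equilibrium

open scoped InnerProductSpace Topology

variable {d12 d13 θ : ℝ} {p q : Config}

theorem sum_matE_mul (d12 d13 θ : ℝ) (p q : Config) (i : Fin 3) (k : Fin 2) :
    ∑ j, matE d12 d13 θ p i j * q (j, k) =
      matE d12 d13 θ p i 1 * relPos 1 q k + matE d12 d13 θ p i 2 * relPos 2 q k := by
  have h := sum_matE d12 d13 θ p i
  rw [Fin.sum_univ_three] at h ⊢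
  rw [relPos_apply, relPos_apply]
  linear_combination q (0, k) * h

theorem relPos_control (hq : q ∈ admissible) (i : Fin 3) :
    relPos i (control d12 d13 θ q) =
      (matE d12 d13 θ q 0 1 - matE d12 d13 θ q i 1) • relPos 1 q +
      (matE d12 d13 θ q 0 2 - matE d12 d13 θ q i 2) • relPos 2 q := by
  ext k
  rw [relPos_apply, control_apply _ _ _ hq, control_apply _ _ _ hq, sum_matE_mul, sum_matE_mul]
  simp only [PiLp.add_apply, PiLp.smul_apply, smul_eq_mul]
  ring

/-- The rate of change of the cosine of the angle along the gradient flow. -/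
theorem cosDeriv_control (hq : q ∈ admissible) :
    cosDeriv q (control d12 d13 θ q) = -(1 - cosAngle q ^ 2) *
      ((matE d12 d13 θ q 1 2 - matE d12 d13 θ q 0 2) * (‖relPos 2 q‖ / ‖relPos 1 q‖) +
        (matE d12 d13 θ q 2 1 - matE d12 d13 θ q 0 1) * (‖relPos 1 q‖ / ‖relPos 2 q‖)) := by
  obtain ⟨h1, h2⟩ := mem_admissible_iff.mp hq
  have ha : ‖relPos 1 q‖ ≠ 0 := norm_ne_zero_iff.2 h1
  have hb : ‖relPos 2 q‖ ≠ 0 := norm_ne_zero_iff.2 h2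
  rw [cosDeriv_apply, relPos_control hq, relPos_control hq]
  simp only [inner_add_right, inner_smul_right, real_inner_comm (relPos 1 q) (relPos 2 q),
    real_inner_self_eq_norm_sq]
  rw [inner_relPos hq]
  field_simp
  ring

/-- At an incorrect equilibrium both distances are correct, the agents are collinear, and the
angle is wrong. -/
theorem incorrectEquilibria_spec (hp : p ∈ incorrectEquilibria d12 d13 θ) :
    err d12 d13 θ p 0 = 0 ∧ err d12 d13 θ p 1 = 0 ∧ cosAngle p ^ 2 = 1 ∧
      0 < cosAngle p * err d12 d13 θ p 2 ∧
      relPos 2 p = (cosAngle p * ‖relPos 2 p‖ / ‖relPos 1 p‖) • relPos 1 p := by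
  obtain ⟨hadm, hu, he⟩ := hp
  obtain ⟨h1, h2⟩ := mem_admissible_iff.mp hadm
  have ha : ‖relPos 1 p‖ ≠ 0 := norm_ne_zero_iff.2 h1
  have hb : ‖relPos 2 p‖ ≠ 0 := norm_ne_zero_iff.2 h2
  have hE : ∀ i, matE d12 d13 θ p i 1 • relPos 1 p + matE d12 d13 θ p i 2 • relPos 2 p = 0 := by
    intro i
    ext k
    have h0 : control d12 d13 θ p (i, k) = 0 := by simp [control, hu]
    rw [control_apply _ _ _ hadm, sum_matE_mul, neg_eq_zero] at h0
    simpa using h0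
  have hin := inner_relPos hadm
  -- The cosine terms cancel in these two pairings, leaving 2 e₁₂ a² = 0 and 2 e₁₃ b² = 0.
  have hE1 := congrArg (fun x => ⟪relPos 1 p, x⟫_ℝ) (hE 1)
  have hE2 := congrArg (fun x => ⟪x, relPos 2 p⟫_ℝ) (hE 2)
  simp only [inner_add_right, inner_add_left, inner_smul_right, real_inner_smul_left,
    real_inner_self_eq_norm_sq, inner_zero_right, inner_zero_left] at hE1 hE2
  rw [hin] at hE1 hE2
  simp only [matE, cosCoeff, norm_pos_sub] at hE1 hE2
  simp at hE1 hE2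
  have he0 : err d12 d13 θ p 0 = 0 := by
    field_simp at hE1
    have : err d12 d13 θ p 0 * ‖relPos 1 p‖ ^ 2 = 0 := by linarith
    simpa [h1] using this
  have he1 : err d12 d13 θ p 1 = 0 := by
    field_simp at hE2
    have : err d12 d13 θ p 1 * ‖relPos 2 p‖ ^ 2 = 0 := by linarith
    simpa [h2] using this
  have he2 : err d12 d13 θ p 2 ≠ 0 := by
    intro h
    exact he (funext fun r => by fin_cases r <;> assumption)
  have hY : relPos 2 p = (cosAngle p * ‖relPos 2 p‖ / ‖relPos 1 p‖) • relPos 1 p := by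
    ext k
    have h := congrArg (fun x : EuclideanSpace ℝ (Fin 2) => x k) (hE 1)
    simp only [matE, cosCoeff, norm_pos_sub] at h
    simp [he0] at h
    rw [PiLp.smul_apply, smul_eq_mul]
    field_simp at h ⊢
    have h' : err d12 d13 θ p 2 * (‖relPos 1 p‖ * relPos 2 p k -
        cosAngle p * ‖relPos 2 p‖ * relPos 1 p k) = 0 := by linarith
    linarith [(mul_eq_zero.mp h').resolve_left he2]
  -- Squared norms in `hY` give b² = c² b².
  have hc : cosAngle p ^ 2 = 1 := by
    have h := congrArg (fun x => ‖x‖ ^ 2) hY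
    simp only [norm_smul, mul_pow, Real.norm_eq_abs, sq_abs] at h
    field_simp at h
    exact h.symm
  refine ⟨he0, he1, hc, ?_, hY⟩
  have hcne : cosAngle p ≠ 0 := fun h => by simp [h] at hc
  have hce : cosAngle p * err d12 d13 θ p 2 = 1 - cosAngle p * Real.cos θ := by
    have : err d12 d13 θ p 2 = cosAngle p - Real.cos θ := rfl
    rw [this, mul_sub, ← sq, hc]
  refine lt_of_le_of_ne ?_ (mul_ne_zero hcne he2).symm
  rw [hce, sub_nonneg]
  have habs : |cosAngle p * Real.cos θ| ≤ 1 := by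
    rw [abs_mul]
    exact mul_le_one₀ (Real.abs_cos_le_one _) (abs_nonneg _) (Real.abs_cos_le_one _)
  exact (le_abs_self _).trans habs

theorem collinear_range_pos {t : ℝ} (h : relPos 2 p = t • relPos 1 p) :
    Collinear ℝ (Set.range (pos p)) := by
  rw [collinear_iff_of_mem (Set.mem_range_self 0)]
  refine ⟨relPos 1 p, ?_⟩
  rintro _ ⟨i, rfl⟩
  fin_cases i
  · exact ⟨0, by simp⟩
  · exact ⟨1, by simp [relPos_eq]⟩
  · exact ⟨t, by rw [← h, vadd_eq_add]; exact (sub_add_cancel _ _).symm⟩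

/-- A vector that spans the range of `E` at an incorrect equilibrium. -/
def escapeVec (p : Config) : Fin 3 → ℝ :=
  ![‖relPos 1 p‖⁻¹ - cosAngle p * ‖relPos 2 p‖⁻¹, -‖relPos 1 p‖⁻¹, cosAngle p * ‖relPos 2 p‖⁻¹]

/-- With e₁₂ = e₁₃ = 0 only the cosine part of E remains, and c² = 1 makes it a rank one matrix. -/
theorem matE_eq (hp : p ∈ incorrectEquilibria d12 d13 θ) (i j : Fin 3) :
    matE d12 d13 θ p i j =
      -(cosAngle p * err d12 d13 θ p 2) * (escapeVec p i * escapeVec p j) := by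
  obtain ⟨h0, h1, hc, -, -⟩ := incorrectEquilibria_spec hp
  simp only [matE, cosCoeff, escapeVec, norm_pos_sub, h0, h1, div_eq_mul_inv, mul_inv, ← inv_pow]
  generalize err d12 d13 θ p 2 = e
  generalize ‖relPos 1 p‖⁻¹ = x
  generalize ‖relPos 2 p‖⁻¹ = y
  generalize cosAngle p = c at hc
  fin_cases i <;> fin_cases j <;> simp <;> grind

theorem escapeVec_one_ne_zero (hp : p ∈ admissible) : escapeVec p 1 ≠ 0 :=
  neg_ne_zero.2 (inv_ne_zero (norm_ne_zero_iff.2 (mem_admissible_iff.mp hp).1))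

/-- By the rank one form, the eigenvalue is -(c e) ‖v‖². -/
theorem matE_mulVec_escapeVec (hp : p ∈ incorrectEquilibria d12 d13 θ) :
    ∃ μ < 0, ∀ i, ∑ j, matE d12 d13 θ p i j * escapeVec p j = μ * escapeVec p i := by
  obtain ⟨-, -, -, hpos, -⟩ := incorrectEquilibria_spec hp
  refine ⟨-(cosAngle p * err d12 d13 θ p 2) * ∑ j, escapeVec p j ^ 2, ?_, fun i => ?_⟩
  · refine mul_neg_of_neg_of_pos (neg_neg_of_pos hpos) ?_
    exact Finset.sum_pos' (fun j _ => sq_nonneg _)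
      ⟨1, Finset.mem_univ _, sq_pos_of_ne_zero (escapeVec_one_ne_zero hp.1)⟩
  · simp_rw [matE_eq hp, Finset.mul_sum, Finset.sum_mul]
    exact Finset.sum_congr rfl fun j _ => by ring

theorem hasNegEigenvalue_of_mulVec {n : Type*} [Fintype n] [DecidableEq n] {A : Matrix n n ℝ}
    {v : n → ℝ} {μ : ℝ} (hμ : μ < 0) (hv : v ≠ 0) (h : A *ᵥ v = μ • v) : HasNegEigenvalue A :=
  ⟨μ, hμ, Module.End.hasEigenvalue_of_hasEigenvector (x := v)
    ⟨Module.End.mem_eigenspace_iff.2 (by rwa [Matrix.toLin'_apply]), hv⟩⟩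

theorem hasNegEigenvalue_matE (hp : p ∈ incorrectEquilibria d12 d13 θ) :
    HasNegEigenvalue (matE d12 d13 θ p) := by
  obtain ⟨μ, hμ, h⟩ := matE_mulVec_escapeVec hp
  exact hasNegEigenvalue_of_mulVec hμ
    (fun h0 => escapeVec_one_ne_zero hp.1 (congrFun h0 1)) (funext h)

end Equilibrium

/-! ### The Jacobian and its block form -/

section Linearization

open scoped InnerProductSpace Topology

variable {d12 d13 θ : ℝ} {p q : Config}

/-- An entry of the matrix `E` as a function of the two distances and the cosine of the angle. -/
def matEOf (d12 d13 θ : ℝ) (i j : Fin 3) (x : ℝ × ℝ × ℝ) : ℝ :=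
  (show Matrix (Fin 3) (Fin 3) ℝ from
    !![2 * (x.1 ^ 2 - d12 ^ 2) + 2 * (x.2.1 ^ 2 - d13 ^ 2), -2 * (x.1 ^ 2 - d12 ^ 2),
        -2 * (x.2.1 ^ 2 - d13 ^ 2);
      -2 * (x.1 ^ 2 - d12 ^ 2), 2 * (x.1 ^ 2 - d12 ^ 2), 0;
      -2 * (x.2.1 ^ 2 - d13 ^ 2), 0, 2 * (x.2.1 ^ 2 - d13 ^ 2)] +
    (x.2.2 - Real.cos θ) •
      !![2 / (x.1 * x.2.1) - x.2.2 / x.1 ^ 2 - x.2.2 / x.2.1 ^ 2,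
          -1 / (x.1 * x.2.1) + x.2.2 / x.1 ^ 2, -1 / (x.1 * x.2.1) + x.2.2 / x.2.1 ^ 2;
         -1 / (x.1 * x.2.1) + x.2.2 / x.1 ^ 2, -x.2.2 / x.1 ^ 2, 1 / (x.1 * x.2.1);
         -1 / (x.1 * x.2.1) + x.2.2 / x.2.1 ^ 2, 1 / (x.1 * x.2.1), -x.2.2 / x.2.1 ^ 2]) i j

theorem matE_eq_matEOf (i j : Fin 3) (q : Config) :
    matE d12 d13 θ q i j =
      matEOf d12 d13 θ i j (‖relPos 1 q‖, ‖relPos 2 q‖, cosAngle q) := by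
  simp only [matE, cosCoeff, matEOf, norm_pos_sub, err, rigidityFun, Pi.sub_apply]
  rfl

theorem differentiableAt_matEOf (i j : Fin 3) {x : ℝ × ℝ × ℝ} (h1 : x.1 ≠ 0) (h2 : x.2.1 ≠ 0) :
    DifferentiableAt ℝ (matEOf d12 d13 θ i j) x := by
  have h12 : x.1 * x.2.1 ≠ 0 := mul_ne_zero h1 h2
  have h1' : x.1 ^ 2 ≠ 0 := pow_ne_zero 2 h1
  have h2' : x.2.1 ^ 2 ≠ 0 := pow_ne_zero 2 h2
  unfold matEOf
  fin_cases i <;> fin_cases j <;> simp <;> fun_prop (disch := assumption)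

/-- In this chain rule form the derivative of E vanishes in every direction that fixes both
distances and the cosine to first order. -/
theorem hasFDerivAt_matE (hq : q ∈ admissible) (i j : Fin 3) :
    HasFDerivAt (fun q => matE d12 d13 θ q i j)
      ((fderiv ℝ (matEOf d12 d13 θ i j) (‖relPos 1 q‖, ‖relPos 2 q‖, cosAngle q)).comp
        ((normDeriv 1 q).prod ((normDeriv 2 q).prod (cosDeriv q)))) q := by
  obtain ⟨h1, h2⟩ := mem_admissible_iff.mp hq
  simp only [matE_eq_matEOf]
  exact (differentiableAt_matEOf i j (norm_ne_zero_iff.2 h1)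
    (norm_ne_zero_iff.2 h2)).hasFDerivAt.comp q
      ((hasFDerivAt_norm h1).prodMk ((hasFDerivAt_norm h2).prodMk (hasFDerivAt_cosAngle hq)))

/-- To first order, `E` does not change when collinear agents are displaced perpendicularly to
their line. -/
theorem fderiv_matE_eq_zero (hq : q ∈ admissible) {t : ℝ} (ht : relPos 2 q = t • relPos 1 q)
    {v : Config} (hv : ∀ i, ⟪relPos 1 q, relPos i v⟫_ℝ = 0) (i j : Fin 3) :
    fderiv ℝ (fun q => matE d12 d13 θ q i j) q v = 0 := by
  have h1 : normDeriv 1 q v = 0 := by rw [normDeriv_apply, hv, mul_zero]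
  have h2 : normDeriv 2 q v = 0 := by
    rw [normDeriv_apply, ht, real_inner_smul_left, hv, mul_zero, mul_zero]
  have h3 : cosDeriv q v = 0 := by
    rw [cosDeriv_apply, ht, real_inner_smul_left, real_inner_smul_left, hv, hv]
    simp
  rw [(hasFDerivAt_matE hq i j).fderiv]
  simp only [ContinuousLinearMap.comp_apply, ContinuousLinearMap.prod_apply, h1, h2, h3]
  exact map_zero _

theorem sum_fderiv_matE (hq : q ∈ admissible) (i : Fin 3) (v : Config) :
    ∑ j, fderiv ℝ (fun q => matE d12 d13 θ q i j) q v = 0 := by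
  have h : HasFDerivAt (fun q => ∑ j, matE d12 d13 θ q i j)
      (∑ j, fderiv ℝ (fun q => matE d12 d13 θ q i j) q) q :=
    HasFDerivAt.fun_sum fun j _ => (hasFDerivAt_matE hq i j).differentiableAt.hasFDerivAt
  simp only [sum_matE] at h
  have := congrArg (fun L : Config →L[ℝ] ℝ => L v) (h.unique (hasFDerivAt_const 0 q))
  simpa using this

/-- The linearization of the control law. -/
theorem fderiv_control_apply (hq : q ∈ admissible) (v : Config) (i : Fin 3) (k : Fin 2) :
    fderiv ℝ (control d12 d13 θ) q v (i, k) =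
      -∑ j, (matE d12 d13 θ q i j * v (j, k) +
        q (j, k) * fderiv ℝ (fun q => matE d12 d13 θ q i j) q v) := by
  have hd : DifferentiableAt ℝ (control d12 d13 θ) q :=
    (contDiffAt_control d12 d13 θ hq).differentiableAt one_ne_zero
  let π (x : Fin 3 × Fin 2) : Config →L[ℝ] ℝ := EuclideanSpace.proj x
  have h1 : HasFDerivAt (fun q => control d12 d13 θ q (i, k))
      ((π (i, k)).comp (fderiv ℝ (control d12 d13 θ) q)) q :=
    (π (i, k)).hasFDerivAt.comp q hd.hasFDerivAt
  have h2 : HasFDerivAt (fun q : Config => -∑ j, matE d12 d13 θ q i j * q (j, k))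
      (-∑ j, (matE d12 d13 θ q i j • π (j, k) +
        q (j, k) • fderiv ℝ (fun q => matE d12 d13 θ q i j) q)) q :=
    (HasFDerivAt.fun_sum fun j _ =>
      (hasFDerivAt_matE hq i j).differentiableAt.hasFDerivAt.mul (π (j, k)).hasFDerivAt).neg
  have heq : (fun q => control d12 d13 θ q (i, k)) =ᶠ[𝓝 q]
      fun q : Config => -∑ j, matE d12 d13 θ q i j * q (j, k) :=
    Filter.eventually_of_mem (isOpen_admissible.mem_nhds hq) fun q hq =>
      control_apply d12 d13 θ hq i k
  have := congrArg (fun L : Config →L[ℝ] ℝ => L v) (h1.unique (h2.congr_of_eventuallyEq heq))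
  simpa [π] using this

theorem negJacobian_mulVec (v : Config) (x : Fin 3 × Fin 2) :
    (negJacobian d12 d13 θ q *ᵥ v) x = -(fderiv ℝ (control d12 d13 θ) q v) x := by
  have hv : v = ∑ y, v y • EuclideanSpace.single y (1 : ℝ) := by
    ext z
    simp [Finset.sum_apply, Pi.single_apply]
  conv_rhs => rw [hv, map_sum]
  simp [negJacobian, mulVec, dotProduct, mul_comm]

/-- The vector obtained by rotating `x` by a right angle. -/
def perp (x : EuclideanSpace ℝ (Fin 2)) : EuclideanSpace ℝ (Fin 2) := !₂[-x 1, x 0]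

theorem inner_perp (x : EuclideanSpace ℝ (Fin 2)) : ⟪x, perp x⟫_ℝ = 0 := by
  simp [perp, PiLp.inner_apply, Fin.sum_univ_two]
  ring

theorem norm_perp (x : EuclideanSpace ℝ (Fin 2)) : ‖perp x‖ = ‖x‖ := by
  simp [perp, EuclideanSpace.norm_eq, Fin.sum_univ_two, add_comm]

/-- The displacement that moves agent `i` by `w i` times the vector `n`. -/
def displacement (w : Fin 3 → ℝ) (n : EuclideanSpace ℝ (Fin 2)) : Config :=
  WithLp.toLp 2 fun x => w x.1 * n x.2

theorem relPos_displacement (w : Fin 3 → ℝ) (n : EuclideanSpace ℝ (Fin 2)) (i : Fin 3) :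
    relPos i (displacement w n) = (w i - w 0) • n := by
  ext k
  simp [relPos_apply, displacement, sub_mul]

/-- `J` acts like `E` on displacements perpendicular to the line of the agents. -/
theorem negJacobian_mulVec_displacement (hq : q ∈ admissible) {t : ℝ}
    (ht : relPos 2 q = t • relPos 1 q) (w : Fin 3 → ℝ) {n : EuclideanSpace ℝ (Fin 2)}
    (hn : ⟪relPos 1 q, n⟫_ℝ = 0) (i : Fin 3) (k : Fin 2) :
    (negJacobian d12 d13 θ q *ᵥ displacement w n) (i, k) =
      (∑ j, matE d12 d13 θ q i j * w j) * n k := by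
  have hv : ∀ i, ⟪relPos 1 q, relPos i (displacement w n)⟫_ℝ = 0 := fun i => by
    rw [relPos_displacement, inner_smul_right, hn, mul_zero]
  rw [negJacobian_mulVec, fderiv_control_apply hq, neg_neg, Finset.sum_mul]
  refine Finset.sum_congr rfl fun j _ => ?_
  rw [fderiv_matE_eq_zero hq ht hv]
  simp [displacement, mul_assoc]

theorem hasNegEigenvalue_negJacobian (hp : p ∈ incorrectEquilibria d12 d13 θ) :
    HasNegEigenvalue (negJacobian d12 d13 θ p) := by
  obtain ⟨μ, hμ, h⟩ := matE_mulVec_escapeVec hp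
  obtain ⟨-, -, -, -, hY⟩ := incorrectEquilibria_spec hp
  refine hasNegEigenvalue_of_mulVec (v := displacement (escapeVec p) (perp (relPos 1 p))) hμ ?_ ?_
  · intro h0
    have hX : perp (relPos 1 p) = 0 := by
      ext k
      exact (mul_eq_zero.mp (congrFun h0 (1, k))).resolve_left (escapeVec_one_ne_zero hp.1)
    rw [← norm_eq_zero, norm_perp, norm_eq_zero] at hX
    exact (mem_admissible_iff.mp hp.1).1 hX
  · ext ⟨i, k⟩
    rw [negJacobian_mulVec_displacement hp.1 hY _ (inner_perp _), h]
    exact mul_assoc _ _ _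

/-- Product rule for (E ⊗ I₂) p: the term E ⊗ I₂, plus the term from differentiating E. -/
theorem negJacobian_apply (hq : q ∈ admissible) (i j : Fin 3) (k l : Fin 2) :
    negJacobian d12 d13 θ q (i, k) (j, l) =
      matE d12 d13 θ q i j * (1 : Matrix (Fin 2) (Fin 2) ℝ) k l +
      ∑ m, q (m, k) *
        fderiv ℝ (fun q => matE d12 d13 θ q i m) q (EuclideanSpace.single (j, l) 1) := by
  rw [negJacobian, Matrix.of_apply, fderiv_control_apply hq, neg_neg, Finset.sum_add_distrib]
  congr 1
  by_cases hkl : k = l <;> simp [Matrix.one_apply, hkl]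

/-- The entries of the negative Jacobian in a rotated frame. -/
theorem rotated_negJacobian_apply (hq : q ∈ admissible) {Q : Matrix (Fin 2) (Fin 2) ℝ}
    (hQ : Q * Qᵀ = 1) (i j : Fin 3) (k l : Fin 2) :
    (((1 : Matrix (Fin 3) (Fin 3) ℝ) ⊗ₖ Q) * negJacobian d12 d13 θ q *
      ((1 : Matrix (Fin 3) (Fin 3) ℝ) ⊗ₖ Q)ᵀ) (i, k) (j, l) =
      matE d12 d13 θ q i j * (1 : Matrix (Fin 2) (Fin 2) ℝ) k l +
      ∑ m, (Q *ᵥ pos q m) k * fderiv ℝ (fun q => matE d12 d13 θ q i m) q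
        (displacement (Pi.single j 1) (WithLp.toLp 2 (Q l))) := by
  have hw : displacement (Pi.single j 1) (WithLp.toLp 2 (Q l)) =
      ∑ l', Q l l' • EuclideanSpace.single (j, l') (1 : ℝ) := by
    ext ⟨i', k'⟩
    fin_cases k' <;> by_cases h : i' = j <;>
      simp [displacement, Fin.sum_univ_two, Pi.single_apply, h]
  -- The entry of the identity is written as one of Q Qᵀ, the form in which it appears after
  -- conjugation.
  have hQkl := congrFun (congrFun hQ k) l
  rw [← hQkl, hw]
  simp only [Matrix.mul_apply, Fintype.sum_prod_type, kroneckerMap_apply, Matrix.one_apply,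
    Matrix.transpose_apply, ite_mul, one_mul, zero_mul, Finset.sum_ite_irrel, Finset.sum_const_zero,
    Finset.sum_ite_eq, Finset.mem_univ, if_true, mul_ite, mul_zero,
    negJacobian_apply hq, map_sum, map_smul, smul_eq_mul, mulVec, dotProduct, pos]
  simp only [Fin.sum_univ_two, Fin.sum_univ_three]
  simp
  ring

theorem rotatedNegJacobian_eq_fromBlocks (hp : p ∈ incorrectEquilibria d12 d13 θ)
    {Q : Matrix (Fin 2) (Fin 2) ℝ} (hQ : Q ∈ Matrix.specialOrthogonalGroup (Fin 2) ℝ)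
    (hline : ∀ i j : Fin 3, (Q.mulVec (pos p i)) 1 = (Q.mulVec (pos p j)) 1) :
    ∃ J₁₁ : Matrix (Fin 3) (Fin 3) ℝ,
      rotatedNegJacobian d12 d13 θ Q p = Matrix.fromBlocks J₁₁ 0 0 (matE d12 d13 θ p) := by
  obtain ⟨-, -, -, -, hY⟩ := incorrectEquilibria_spec hp
  have hQQ : Q * Qᵀ = 1 :=
    (Matrix.mem_orthogonalGroup_iff (Fin 2) ℝ).mp (mem_specialOrthogonalGroup_iff.mp hQ).1
  -- The second row of Q is normal to the line of the agents.
  have hX : ⟪relPos 1 p, WithLp.toLp 2 (Q 1)⟫_ℝ = 0 := by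
    have := hline 1 0
    simp [mulVec, dotProduct, Fin.sum_univ_two] at this
    simp [relPos_eq, PiLp.inner_apply, Fin.sum_univ_two]
    linarith
  -- Rows for second coordinates: the rotated second coordinates agree for all agents, and the
  -- derivatives along a row of E sum to zero.
  have hsum : ∀ i v, ∑ m, (Q *ᵥ pos p m) 1 * fderiv ℝ (fun q => matE d12 d13 θ q i m) p v = 0 := by
    intro i v
    simp_rw [hline _ 0]
    rw [← Finset.mul_sum, sum_fderiv_matE hp.1, mul_zero]
  -- Columns for second coordinates: these displacements are normal to the line, so E is constant to
  -- first order.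
  have hperp : ∀ i m j, fderiv ℝ (fun q => matE d12 d13 θ q i m) p
      (displacement (Pi.single j 1) (WithLp.toLp 2 (Q 1))) = 0 := fun i m j =>
    fderiv_matE_eq_zero hp.1 hY
      (fun r => by rw [relPos_displacement, inner_smul_right, hX, mul_zero]) i m
  refine ⟨(rotatedNegJacobian d12 d13 θ Q p).toBlocks₁₁, ?_⟩
  ext (i | i) (j | j)
  · rfl
  all_goals
    simp only [rotatedNegJacobian, submatrix_apply, coordOrder, Sum.elim_inl, Sum.elim_inr,
      rotated_negJacobian_apply hp.1 hQQ, hsum, hperp]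
    simp

end Linearization

/-! ### Growth of the angle deviation and instability -/

section Unstable

open scoped InnerProductSpace Topology

variable {d12 d13 θ : ℝ} {p q : Config}

/-- The factor of `-(1 - cos² θ₂₃¹)` in the rate of change of `cos θ₂₃¹` along the flow. -/
def angleRate (d12 d13 θ : ℝ) (q : Config) : ℝ :=
  (matE d12 d13 θ q 1 2 - matE d12 d13 θ q 0 2) * (‖relPos 2 q‖ / ‖relPos 1 q‖) +
    (matE d12 d13 θ q 2 1 - matE d12 d13 θ q 0 1) * (‖relPos 1 q‖ / ‖relPos 2 q‖)

theorem continuousAt_angleRate (hq : q ∈ admissible) :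
    ContinuousAt (angleRate d12 d13 θ) q := by
  obtain ⟨h1, h2⟩ := mem_admissible_iff.mp hq
  have hE : ∀ i j, ContinuousAt (fun q => matE d12 d13 θ q i j) q := fun i j =>
    (hasFDerivAt_matE hq i j).continuousAt
  have c1 := (hasFDerivAt_norm h1).continuousAt
  have c2 := (hasFDerivAt_norm h2).continuousAt
  exact (((hE 1 2).sub (hE 0 2)).mul (c2.div c1 (norm_ne_zero_iff.2 h1))).add
    (((hE 2 1).sub (hE 0 1)).mul (c1.div c2 (norm_ne_zero_iff.2 h2)))

/-- The rank one form of E and c² = 1 turn the product into a positive multiple of c e (a² + b² - c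
a b), where c ≤ 1 and a² + b² > a b. -/
theorem cosAngle_mul_angleRate_pos (hp : p ∈ incorrectEquilibria d12 d13 θ) :
    0 < cosAngle p * angleRate d12 d13 θ p := by
  obtain ⟨-, -, hc, hpos, -⟩ := incorrectEquilibria_spec hp
  obtain ⟨h1, h2⟩ := mem_admissible_iff.mp hp.1
  have ha : 0 < ‖relPos 1 p‖ := norm_pos_iff.2 h1
  have hb : 0 < ‖relPos 2 p‖ := norm_pos_iff.2 h2
  have hcle : cosAngle p ≤ 1 := (abs_le_one_iff_mul_self_le_one.2 (by nlinarith) |> abs_le.1).2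
  simp only [angleRate, matE_eq hp]
  simp only [escapeVec, cons_val]
  generalize ‖relPos 1 p‖ = a at *
  generalize ‖relPos 2 p‖ = b at *
  generalize cosAngle p = c at *
  generalize err d12 d13 θ p 2 = e at *
  have key : c * ((-(c * e) * (-a⁻¹ * (c * b⁻¹)) - -(c * e) * ((a⁻¹ - c * b⁻¹) * (c * b⁻¹))) *
      (b / a) + (-(c * e) * (c * b⁻¹ * -a⁻¹) - -(c * e) * ((a⁻¹ - c * b⁻¹) * -a⁻¹)) * (a / b)) =
      c * e * (2 * c ^ 2 * (a ^ 2 + b ^ 2) - (c ^ 2 + 1) * c * (a * b)) / (a ^ 2 * b ^ 2) := by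
    field_simp
    ring
  rw [key, hc]
  have hab : 0 < a * b := mul_pos ha hb
  have : 0 < 2 * 1 * (a ^ 2 + b ^ 2) - (1 + 1) * c * (a * b) := by
    nlinarith [sq_nonneg (a - b), mul_nonneg (sub_nonneg.2 hcle) hab.le]
  positivity

/-- Arbitrarily close to a collinear configuration there are configurations with a different angle
at the first agent. -/
theorem frequently_cosAngle_mul_lt_one (hq : q ∈ admissible) {t : ℝ}
    (ht : relPos 2 q = t • relPos 1 q) (hc : cosAngle q ^ 2 = 1) :
    ∃ᶠ x in 𝓝 q, 0 < 1 - cosAngle q * cosAngle x := by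
  have hX := (mem_admissible_iff.mp hq).1
  have ha : 0 < ‖relPos 1 q‖ := norm_pos_iff.2 hX
  -- Moving agent 2 normally to the line preserves ⟪X, Y⟫ and ‖Y‖ but lengthens X, so the absolute
  -- value of the cosine drops below 1.
  let w := displacement ![0, 1, 0] (perp (relPos 1 q))
  have htend : Filter.Tendsto (fun s : ℝ => q + s • w) (𝓝[≠] 0) (𝓝 q) := by
    have : ContinuousAt (fun s : ℝ => q + s • w) 0 := by fun_prop
    simpa [ContinuousAt] using this.tendsto.mono_left nhdsWithin_le_nhds
  refine htend.frequently (Filter.Eventually.frequently ?_)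
  filter_upwards [self_mem_nhdsWithin,
    htend.eventually (isOpen_admissible.mem_nhds hq)] with s hs hadm
  have hs : s ≠ 0 := hs
  have hb := norm_pos_iff.2 (mem_admissible_iff.mp hadm).2
  have ha' := norm_pos_iff.2 (mem_admissible_iff.mp hadm).1
  have h1 : relPos 1 (q + s • w) = relPos 1 q + s • perp (relPos 1 q) := by
    simp [w, relPos_displacement]
  have h2 : relPos 2 (q + s • w) = relPos 2 q := by
    simp [w, relPos_displacement]
  have hin : ⟪relPos 1 (q + s • w), relPos 2 (q + s • w)⟫_ℝ = ⟪relPos 1 q, relPos 2 q⟫_ℝ := by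
    rw [h1, h2, inner_add_left, real_inner_smul_left]
    rw [ht, inner_smul_right, inner_smul_right, real_inner_comm _ (perp _), inner_perp]
    simp
  have hlt : ‖relPos 1 q‖ < ‖relPos 1 (q + s • w)‖ := by
    refine lt_of_pow_lt_pow_left₀ 2 (norm_nonneg _) ?_
    rw [h1, norm_add_sq_real, inner_smul_right, inner_perp, norm_smul, norm_perp, mul_pow,
      Real.norm_eq_abs, sq_abs]
    have : 0 < s ^ 2 * ‖relPos 1 q‖ ^ 2 := by positivity
    linarith
  rw [inner_relPos hadm, inner_relPos hq, h2] at hin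
  rw [h2] at hb
  have hin' : cosAngle (q + s • w) * ‖relPos 1 (q + s • w)‖ = cosAngle q * ‖relPos 1 q‖ :=
    mul_right_cancel₀ hb.ne' (by linarith)
  have : cosAngle q * cosAngle (q + s • w) * ‖relPos 1 (q + s • w)‖ = ‖relPos 1 q‖ := by
    rw [mul_assoc, hin', ← mul_assoc, ← sq, hc, one_mul]
  by_contra! hle
  nlinarith

theorem not_isStable_control (hp : p ∈ incorrectEquilibria d12 d13 θ) :
    ¬ IsStable (control d12 d13 θ) admissible p := by
  obtain ⟨-, -, hc, -, hY⟩ := incorrectEquilibria_spec hp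
  have hadm : ∀ᶠ q in 𝓝 p, q ∈ admissible := isOpen_admissible.mem_nhds hp.1
  let σ := cosAngle p
  let rate : Config → ℝ := fun q => σ * angleRate d12 d13 θ q * (1 + σ * cosAngle q)
  have hrate : 0 < rate p := by
    have h2 : (1 : ℝ) + σ * cosAngle p = 2 := by
      have : σ * cosAngle p = 1 := by rw [← sq, hc]
      linarith
    simp only [rate, h2]
    exact mul_pos (cosAngle_mul_angleRate_pos hp) two_pos
  have hcont : ContinuousAt rate p :=
    (continuousAt_const.mul (continuousAt_angleRate hp.1)).mul
      (continuousAt_const.add (continuousAt_const.mul (hasFDerivAt_cosAngle hp.1).continuousAt))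
  have hW : ∀ q, σ * cosAngle q ≤ 1 ∧ -1 ≤ σ * cosAngle q := by
    intro q
    have h : |σ * cosAngle q| ≤ 1 := by
      rw [abs_mul]
      exact mul_le_one₀ (Real.abs_cos_le_one _) (abs_nonneg _) (Real.abs_cos_le_one _)
    exact ⟨(abs_le.1 h).2, (abs_le.1 h).1⟩
  refine not_isStable_of_chetaev (W := fun q => 1 - σ * cosAngle q)
    (W' := fun q => -(σ • cosDeriv q)) (κ := rate p / 2) (M := 2) (half_pos hrate)
    (fun q => by linarith [(hW q).2])
    (hadm.mono fun q hq => contDiffAt_control d12 d13 θ hq) hadm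
    (hadm.mono fun q hq => ((hasFDerivAt_cosAngle hq).const_mul σ).const_sub 1) ?_
    (frequently_cosAngle_mul_lt_one hp.1 hY hc)
  filter_upwards [hadm, hcont.eventually_const_lt (half_lt_self hrate)] with q hq hlt
  -- Since σ² = 1, 1 - cos² factors as (1 - σ cos)(1 + σ cos); the first factor is W and the second
  -- belongs to `rate`.
  have hderiv : (-(σ • cosDeriv q)) (control d12 d13 θ q) = rate q * (1 - σ * cosAngle q) := by
    have hσ : σ ^ 2 = 1 := hc
    have h : cosDeriv q (control d12 d13 θ q) = -(1 - cosAngle q ^ 2) * angleRate d12 d13 θ q :=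
      cosDeriv_control hq
    simp only [_root_.neg_apply, _root_.smul_apply, h, smul_eq_mul, rate]
    linear_combination σ * angleRate d12 d13 θ q * cosAngle q ^ 2 * hσ
  rw [hderiv]
  exact mul_le_mul_of_nonneg_right hlt.le (sub_nonneg.2 (hW q).1)

end Unstable

end WeakRigidity

end

theorem mainTheorem4 (d12 d13 θ : ℝ) (hθ : θ ∈ Set.Icc 0 Real.pi)
    (p : WeakRigidity.Config) (hp : p ∈ WeakRigidity.incorrectEquilibria d12 d13 θ) :
    ¬ WeakRigidity.IsStable (WeakRigidity.control d12 d13 θ) WeakRigidity.admissible p ∧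
    Collinear ℝ (Set.range (WeakRigidity.pos p)) ∧
    WeakRigidity.HasNegEigenvalue (WeakRigidity.matE d12 d13 θ p) ∧
    WeakRigidity.HasNegEigenvalue (WeakRigidity.negJacobian d12 d13 θ p) ∧
    ∀ Q ∈ Matrix.specialOrthogonalGroup (Fin 2) ℝ,
      (∀ i j : Fin 3, (Q.mulVec (WeakRigidity.pos p i)) 1 = (Q.mulVec (WeakRigidity.pos p j)) 1) →
      ∃ J₁₁ : Matrix (Fin 3) (Fin 3) ℝ,
        WeakRigidity.rotatedNegJacobian d12 d13 θ Q p =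
          Matrix.fromBlocks J₁₁ 0 0 (WeakRigidity.matE d12 d13 θ p) := by
  obtain ⟨-, -, -, -, hY⟩ := WeakRigidity.incorrectEquilibria_spec hp
  exact ⟨WeakRigidity.not_isStable_control hp, WeakRigidity.collinear_range_pos hY,
    WeakRigidity.hasNegEigenvalue_matE hp, WeakRigidity.hasNegEigenvalue_negJacobian hp,
    fun Q hQ hline => WeakRigidity.rotatedNegJacobian_eq_fromBlocks hp hQ hline⟩
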